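/- Let $X=\ell^2(\mathbb{Z})$ be equipped with a scalar product $\langle\cdot,\cdot\rangle$ and a fixed orthonormal basis $(e_i)_{i\in\mathbb{Z}}$, and write $A_{i,j}=\langle Ae_j,e_i\rangle$ for the matrix entries of a bounded linear operator $A$ on $X$. Let $U_{-1},U_0,U_1\subset\mathbb{C}$ be non-empty compact sets. Let $M(U_{-1},U_0,U_1)$ be the set of bounded operators $A$ on $X$ with $A_{i+k,i}\in U_k$ for all $i\in\mathbb{Z}$, $k\in\{-1,0,1\}$, and $A_{i+k,i}=0$ for all $i\in\mathbb{Z}$, $k\notin\{-1,0,1\}$; let $M_{fin}(U_{-1},U_0,U_1)$ be the set of finite square matrices with the same property. Let $P_{k,l}$ be the orthogonal projection onto $\operatorname{span}\{e_k,\dots,e_l\}$. An operator $A\in M(U_{-1},U_0,U_1)$ is called pseudo-ergodic, written $A\in\Psi E(U_{-1},U_0,U_1)$, if for every $\epsilon>0$ and every $B\in M_{fin}(U_{-1},U_0,U_1)$ there are $k,l$ such that $l-k+1$ is the size of $B$ and $\|P_{k,l}AP_{k,l}-B\|\le\epsilon$, where $P_{k,l}AP_{k,l}$ is identified with its matrix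 in the basis $e_k,\dots,e_l$ and $\|\cdot\|$ is the operator norm for the Euclidean norm. Let $N(A)$ be the closure of $\{\langle Ax,x\rangle:\|x\|=1\}$. Then: 1. For every $A\in\Psi E(U_{-1},U_0,U_1)$, $$N(A)=\operatorname{conv}(\operatorname{spec}(A)).$$ 2. Such operators need not be normal: there are non-empty compact sets $U_{-1},U_0,U_1\subset\mathbb{C}$ and an operator $A\in\Psi E(U_{-1},U_0,U_1)$ that is not normal. 3. Let $A$ be a tridiagonal random operator, i.e. a random element of $M(U_{-1},U_0,U_1)$ such that the entries $A_{i+k,i}$ ($i\in\mathbb{Z}$, $k\in\{-1,0,1\}$) are independent random variables and, for each $k\in\{-1,0,1\}$, the entries $A_{i+k,i}$ ($i\in\mathbb{Z}$) all have the same law, a probability measure on $U_k$. Then almost surely $N(A)=\operatorname{conv}(\operatorname{spec}(A))$. -/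

import Mathlib

open MeasureTheory ProbabilityTheory

section BandOperators

/- `H` is a complex Hilbert space with a fixed orthonormal basis `(e i)` indexed by `ℤ`, that is,
`ℓ²(ℤ)` together with a scalar product and an orthonormal basis for it. -/
variable {H : Type*} [NormedAddCommGroup H] [InnerProductSpace ℂ H]

/-- The matrix entry `A_{i,j} = ⟨A e_j, e_i⟩`.
(Mathlib's inner product is linear in the second argument, so the order is reversed.) -/
noncomputable def matrixEntry (e : HilbertBasis ℤ ℂ H) (A : H →L[ℂ] H) (i j : ℤ) : ℂ :=
  inner ℂ (e i) (A (e j))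

/-- The class `M(U_n, …, U_m)` of bounded operators whose `k`-th diagonal `(A_{i+k,i})_i` takes its
values in `U_k` if `n ≤ k ≤ m` and vanishes otherwise. Only the sets `U_n, …, U_m` matter. -/
def bandOperators (e : HilbertBasis ℤ ℂ H) (n m : ℤ) (U : ℤ → Set ℂ) : Set (H →L[ℂ] H) :=
  {A | ∀ i k : ℤ,
    (k ∈ Set.Icc n m → matrixEntry e A (i + k) i ∈ U k) ∧
    (k ∉ Set.Icc n m → matrixEntry e A (i + k) i = 0)}

/-- The finite square matrices of size `d` in `M_fin(U_n, …, U_m)`. -/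
def finBandMatrices (n m : ℤ) (U : ℤ → Set ℂ) (d : ℕ) : Set (Matrix (Fin d) (Fin d) ℂ) :=
  {B | ∀ a b : Fin d,
    ((a : ℤ) - (b : ℤ) ∈ Set.Icc n m → B a b ∈ U ((a : ℤ) - (b : ℤ))) ∧
    ((a : ℤ) - (b : ℤ) ∉ Set.Icc n m → B a b = 0)}

/-- The matrix, in the basis `e_k, …, e_l` with `l = k + d - 1`, of the compression
`P_{k,l} A P_{k,l}` of `A` to the span of these `d` vectors. -/
noncomputable def finiteSection (e : HilbertBasis ℤ ℂ H) (A : H →L[ℂ] H) (k : ℤ) (d : ℕ) :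
    Matrix (Fin d) (Fin d) ℂ :=
  Matrix.of fun a b => matrixEntry e A (k + (a : ℤ)) (k + (b : ℤ))

/-- The class `ΨE(U_n, …, U_m)` of pseudo-ergodic operators: every matrix in `M_fin(U_n, …, U_m)`
is found in `A` along the main diagonal, up to an arbitrarily small error in the operator norm that
belongs to the Euclidean norm. -/
def pseudoErgodicOperators (e : HilbertBasis ℤ ℂ H) (n m : ℤ) (U : ℤ → Set ℂ) :
    Set (H →L[ℂ] H) :=
  {A | A ∈ bandOperators e n m U ∧
    ∀ ε : ℝ, 0 < ε → ∀ (d : ℕ), ∀ B ∈ finBandMatrices n m U d,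
      ∃ k : ℤ, ‖Matrix.toEuclideanCLM (𝕜 := ℂ) (finiteSection e A k d - B)‖ ≤ ε}

/-- The (closed) numerical range `N(A)`, the closure of `{⟨A x, x⟩ : ‖x‖ = 1}`. -/
def closedNumericalRange (A : H →L[ℂ] H) : Set ℂ :=
  closure {z : ℂ | ∃ x : H, ‖x‖ = 1 ∧ z = inner ℂ x (A x)}

/-- `A` is a random operator in `M(U_n, …, U_m)` on the probability space `(Ω, P)`: for each
`k ∈ {n, …, m}` the entries on the `k`-th diagonal have a common law, which is a probability measure
on `U_k`, and all the entries on the diagonals `n, …, m` are independent. -/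
structure IsRandomBandOperator {Ω : Type*} [MeasurableSpace Ω] (P : Measure Ω)
    (e : HilbertBasis ℤ ℂ H) (n m : ℤ) (U : ℤ → Set ℂ) (A : Ω → (H →L[ℂ] H)) : Prop where
  mem : ∀ᵐ ω ∂P, A ω ∈ bandOperators e n m U
  law : ∀ k ∈ Set.Icc n m, ∃ μ : Measure ℂ, IsProbabilityMeasure μ ∧ μ (U k)ᶜ = 0 ∧
    ∀ i : ℤ, HasLaw (fun ω => matrixEntry e (A ω) (i + k) i) μ P
  indep : iIndepFun
    (fun (p : Set.Icc n m × ℤ) ω => matrixEntry e (A ω) (p.2 + (p.1 : ℤ)) p.2) P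

end BandOperators

/-! For any bounded operator the convex hull of the spectrum lies in `N(A)`: the spectrum does, and
`N(A)` is convex (Toeplitz–Hausdorff).

Conversely, compare support functions. Fix `c`. Put `α = max Re(c z)` over the main-diagonal set and
`ρ = max |c y + conj (c z)|` over the two side-diagonal sets. Each pair of side-diagonal entries
couples `x_i` and `x_{i+1}`, so AM-GM gives `Re(c ⟨Ax,x⟩) ≤ α + ρ` for unit `x`
(`re_mul_inner_map_le`). The Laurent operator built from the maximisers attains this bound: at a
suitable unimodular `w` its symbol `l` satisfies `Re(c l) = α + ρ`. Since `A` is close to that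
Laurent operator on arbitrarily long windows, truncated plane waves are approximate eigenvectors and
`l` is in the spectrum (`laurentSymbol_mem_spectrum`).

Only constant diagonals are needed. Pseudo-ergodicity supplies their windows directly; in the random
case the second Borel–Cantelli lemma does, with `U_k` cut down to the support of the law. The
non-normal example is a shift whose 0/1 weights contain every binary word. -/

/-- In finite dimension the convex hull of a compact set is compact. -/
theorem IsCompact.convexHull_of_finiteDimensional {E : Type*} [NormedAddCommGroup E]
    [NormedSpace ℝ E] [FiniteDimensional ℝ E] {S : Set E} (hS : IsCompact S) :
    IsCompact (convexHull ℝ S) := by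
  rcases S.eq_empty_or_nonempty with rfl | ⟨p₀, hp₀⟩
  · simp
  -- Carathéodory: this many points suffice, so the hull is a continuous image of a compact set.
  -- Shorter combinations are padded with weight 0 at `p₀`.
  set ι := Fin (Module.finrank ℝ E + 1)
  have himage : convexHull ℝ S = (fun q : (ι → ℝ) × (ι → E) => ∑ i, q.1 i • q.2 i) ''
      (stdSimplex ℝ ι ×ˢ Set.univ.pi fun _ => S) := by
    ext x
    constructor
    · intro hx
      obtain ⟨κ, _, z, w, hz, hind, hw, hw1, rfl⟩ := eq_pos_convex_span_of_mem_convexHull hx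
      have hcard : Fintype.card κ ≤ Fintype.card ι := by
        rw [Fintype.card_fin]
        exact hind.card_le_finrank_succ.trans
          (Nat.succ_le_succ (Submodule.finrank_le _))
      obtain ⟨g⟩ := Function.Embedding.nonempty_of_card_le hcard
      have hext : ∀ (f : κ → ℝ) i, i ∉ Set.range g → Function.extend g f 0 i = 0 := by
        intro f i hi
        rw [Function.extend_apply' _ _ _ hi, Pi.zero_apply]
      refine ⟨(Function.extend g w 0, Function.extend g z fun _ => p₀), ⟨⟨?_, ?_⟩, ?_⟩, ?_⟩
      · intro i
        by_cases hi : i ∈ Set.range g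
        · obtain ⟨j, rfl⟩ := hi
          simpa [g.injective.extend_apply] using (hw j).le
        · exact (hext w i hi).ge
      · rw [← hw1]
        refine (Fintype.sum_of_injective g g.injective _ _ (hext w) fun i => ?_).symm
        simp [g.injective.extend_apply]
      · intro i _
        by_cases hi : i ∈ Set.range g
        · obtain ⟨j, rfl⟩ := hi
          simpa [g.injective.extend_apply] using hz (Set.mem_range_self j)
        · simpa [Function.extend_apply' _ _ _ hi] using hp₀
      · refine (Fintype.sum_of_injective g g.injective _ _ (fun i hi => ?_) fun i => ?_).symm
        · simp [hext w i hi]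
        · simp [g.injective.extend_apply]
    · rintro ⟨⟨w, z⟩, ⟨⟨hw, hw1⟩, hz⟩, rfl⟩
      exact (convex_convexHull ℝ S).sum_mem (fun i _ => hw i) hw1
        fun i _ => subset_convexHull ℝ S (hz i trivial)
  rw [himage]
  exact ((isCompact_stdSimplex ℝ ι).prod (isCompact_univ_pi fun _ => hS)).image (by fun_prop)

/-! ### Numerical range: convexity, spectrum, support functions -/

section NumericalRange

variable {H : Type*} [NormedAddCommGroup H] [InnerProductSpace ℂ H]

/-- Turning `y` by a phase makes the cross terms real, so the form is real along the segment from
`x` to `c • y`. The Rayleigh quotient then runs continuously from 0 to 1. -/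
theorem exists_norm_one_inner_map_eq_of_zero_of_one (T : H →L[ℂ] H) {x y : H}
    (hx1 : ‖x‖ = 1) (hx : inner ℂ x (T x) = 0) (hy : inner ℂ y (T y) = 1)
    {s : ℝ} (hs : s ∈ Set.Icc (0 : ℝ) 1) (hy1 : ‖y‖ = 1) :
    ∃ z : H, ‖z‖ = 1 ∧ inner ℂ z (T z) = (s : ℂ) := by
  set p := inner ℂ x (T y) with hp
  set q := inner ℂ y (T x) with hq
  obtain ⟨c, hc1, r, hr⟩ : ∃ c : ℂ, ‖c‖ = 1 ∧ ∃ r : ℝ, c * p + (starRingEnd ℂ) c * q = r := by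
    by_cases h0 : p - (starRingEnd ℂ) q = 0
    · refine ⟨1, by simp, 2 * q.re, ?_⟩
      rw [sub_eq_zero.1 h0]
      apply Complex.ext
      · simp; ring
      · simp
    · set d := p - (starRingEnd ℂ) q with hd
      -- The imaginary part of `c p + conj c q` is that of `c d`, and this `c` gives `c d = ‖d‖`.
      refine ⟨(‖d‖ : ℂ)⁻¹ * (starRingEnd ℂ) d, ?_, ?_⟩
      · simp [h0]
      · refine ⟨_, (Complex.conj_eq_iff_re.1 ?_).symm⟩
        have hpq : p = d + (starRingEnd ℂ) q := by rw [hd]; ring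
        rw [hpq]
        simp only [map_add, map_mul, map_inv₀, Complex.conj_ofReal, Complex.conj_conj]
        ring
  set z : ℝ → H := fun t => ((1 - t : ℝ) : ℂ) • x + ((t : ℝ) : ℂ) • (c • y) with hz
  have hcc : (starRingEnd ℂ) c * c = 1 := by
    rw [← Complex.normSq_eq_conj_mul_self, Complex.normSq_eq_norm_sq, hc1]; simp
  have hval : ∀ t, inner ℂ (z t) (T (z t)) = (((1 - t) * t * r + t ^ 2 : ℝ) : ℂ) := by
    intro t
    simp only [hz, map_add, map_smul, inner_add_left, inner_add_right, inner_smul_left,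
      inner_smul_right, Complex.conj_ofReal, hx, hy, ← hp, ← hq]
    push_cast
    rw [← hr]
    linear_combination ((t : ℂ) ^ 2) * hcc
  have hz0 : ∀ t, z t ≠ 0 := by
    intro t ht
    have h1 := hval t
    rw [ht, inner_zero_left] at h1
    have h2 : ((1 - t : ℝ) : ℂ) • x = - (((t : ℝ) : ℂ) • (c • y)) := eq_neg_of_add_eq_zero_left ht
    have h3 : inner ℂ (((1 - t : ℝ) : ℂ) • x) (T (((1 - t : ℝ) : ℂ) • x)) = 0 := by
      simp [hx]
    rw [h2] at h3
    simp only [map_neg, map_smul, inner_neg_left, inner_neg_right, inner_smul_left,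
      inner_smul_right, Complex.conj_ofReal, hy, mul_one] at h3
    have h4 : (t : ℂ) ^ 2 = 0 := by
      linear_combination h3 - (t : ℂ) ^ 2 * hcc
    have ht0 : t = 0 := by simpa using h4
    subst ht0
    simp only [hz] at ht
    simp at ht
    simp [ht] at hx1
  have hcont : Continuous z := by fun_prop
  set f : ℝ → ℝ := fun t => ((1 - t) * t * r + t ^ 2) / ‖z t‖ ^ 2 with hf
  have hfc : Continuous f := by
    apply Continuous.div (by fun_prop) (by fun_prop)
    intro t
    exact pow_ne_zero 2 (norm_ne_zero_iff.2 (hz0 t))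
  have hf0 : f 0 = 0 := by simp [hf]
  have hf1 : f 1 = 1 := by simp [hf, hz, norm_smul, hc1, hy1]
  have hmem : s ∈ f '' Set.Icc 0 1 := by
    apply intermediate_value_Icc zero_le_one hfc.continuousOn
    rwa [hf0, hf1]
  obtain ⟨t, -, ht⟩ := hmem
  have hn : ‖z t‖ ≠ 0 := norm_ne_zero_iff.2 (hz0 t)
  refine ⟨((‖z t‖ : ℂ)⁻¹) • z t, ?_, ?_⟩
  · rw [norm_smul, norm_inv, Complex.norm_real, norm_norm, inv_mul_cancel₀ hn]
  · rw [map_smul, inner_smul_left, inner_smul_right, hval, ← ht, hf]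
    push_cast
    simp only [map_inv₀, Complex.conj_ofReal]
    field_simp

/-- The Toeplitz–Hausdorff theorem. -/
theorem convex_numericalRange (A : H →L[ℂ] H) :
    Convex ℝ {z : ℂ | ∃ x : H, ‖x‖ = 1 ∧ z = inner ℂ x (A x)} := by
  rintro _ ⟨x, hx, rfl⟩ _ ⟨y, hy, rfl⟩ a b ha hb hab
  set u := inner ℂ x (A x) with hu
  set v := inner ℂ y (A y) with hv
  have hxx : inner ℂ x x = (1 : ℂ) := by rw [inner_self_eq_norm_sq_to_K, hx]; simp
  have hyy : inner ℂ y y = (1 : ℂ) := by rw [inner_self_eq_norm_sq_to_K, hy]; simp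
  have hab' : (a : ℂ) = 1 - b := by
    have : a = 1 - b := by linarith
    rw [this]; push_cast; rfl
  by_cases huv : v - u = 0
  · refine ⟨x, hx, ?_⟩
    rw [sub_eq_zero.1 huv, Complex.real_smul, Complex.real_smul, hab']
    ring
  -- An affine change of the operator moves the values `u`, `v` to 0, 1.
  · obtain ⟨z, hz, hz'⟩ := exists_norm_one_inner_map_eq_of_zero_of_one
      ((v - u)⁻¹ • (A - u • (1 : H →L[ℂ] H))) (x := x) (y := y) hx
      (by simp [-inner_self_eq_norm_sq_to_K, hxx, ← hu])
      (by simp [-inner_self_eq_norm_sq_to_K, hyy, ← hv, huv])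
      (s := b) ⟨hb, by linarith⟩ hy
    refine ⟨z, hz, ?_⟩
    have hzz : inner ℂ z z = (1 : ℂ) := by rw [inner_self_eq_norm_sq_to_K, hz]; simp
    simp only [smul_apply, sub_apply, one_apply_eq_self, inner_smul_right, inner_sub_right, hzz] at hz'
    rw [inv_mul_eq_iff_eq_mul₀ huv] at hz'
    rw [Complex.real_smul, Complex.real_smul, hab']
    linear_combination -hz'

/-- At distance `ε` from the closed range, the form of `l - A` is bounded below in modulus by `ε ‖x‖
^ 2`, so `l - A` is invertible as in Lax–Milgram. -/
theorem spectrum_subset_closedNumericalRange [CompleteSpace H] (A : H →L[ℂ] H) :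
    spectrum ℂ A ⊆ closedNumericalRange A := by
  intro l hl
  by_contra hn
  obtain ⟨ε, hε, hball⟩ := Metric.isOpen_iff.1 isClosed_closure.isOpen_compl l hn
  apply hl
  apply ContinuousLinearMap.isUnit_of_forall_le_norm_inner_map _ (c := ⟨ε, hε.le⟩) hε
  intro x
  by_cases hx : x = 0
  · simp [hx]
  have hx0 : ‖x‖ ≠ 0 := norm_ne_zero_iff.2 hx
  have hval : inner ℂ ((algebraMap ℂ (H →L[ℂ] H) l - A) x) x =
      (starRingEnd ℂ) (l * ‖x‖ ^ 2 - inner ℂ x (A x)) := by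
    rw [← inner_conj_symm]
    simp [Algebra.algebraMap_eq_smul_one, inner_sub_right, inner_smul_right,
      inner_self_eq_norm_sq_to_K]
  rw [hval, RCLike.norm_conj]
  have hmem : inner ℂ x (A x) / (‖x‖ : ℂ) ^ 2 ∈
      {z : ℂ | ∃ x : H, ‖x‖ = 1 ∧ z = inner ℂ x (A x)} := by
    refine ⟨((‖x‖ : ℂ)⁻¹) • x, ?_, ?_⟩
    · rw [norm_smul, norm_inv, Complex.norm_real, norm_norm, inv_mul_cancel₀ hx0]
    · rw [map_smul, inner_smul_left, inner_smul_right]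
      simp only [map_inv₀, Complex.conj_ofReal]
      field_simp
  have hd : ε ≤ ‖l - inner ℂ x (A x) / (‖x‖ : ℂ) ^ 2‖ := by
    by_contra hlt
    refine hball (a := inner ℂ x (A x) / (‖x‖ : ℂ) ^ 2) ?_ (subset_closure hmem)
    rw [Metric.mem_ball, dist_comm, dist_eq_norm]
    exact not_le.1 hlt
  have hx0' : (‖x‖ : ℂ) ≠ 0 := by exact_mod_cast hx0
  have heq : l * ‖x‖ ^ 2 - inner ℂ x (A x) =
      (l - inner ℂ x (A x) / (‖x‖ : ℂ) ^ 2) * (‖x‖ : ℂ) ^ 2 := by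
    field_simp
  rw [heq, norm_mul]
  simp only [norm_pow, Complex.norm_real, norm_norm]
  have := mul_le_mul_of_nonneg_left hd (sq_nonneg ‖x‖)
  show ‖x‖ ^ 2 * ε ≤ _
  linarith

theorem convexHull_spectrum_subset_closedNumericalRange [CompleteSpace H] (A : H →L[ℂ] H) :
    convexHull ℝ (spectrum ℂ A) ⊆ closedNumericalRange A :=
  convexHull_min (spectrum_subset_closedNumericalRange A) (convex_numericalRange A).closure

/-- A compact set whose support function dominates that of the numerical range in every direction
has the numerical range in its convex hull. -/
theorem closedNumericalRange_subset_convexHull {A : H →L[ℂ] H} {S : Set ℂ} (hS : IsCompact S)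
    (h : ∀ c : ℂ, ∃ l ∈ S, ∀ x : H, ‖x‖ = 1 → (c * inner ℂ x (A x)).re ≤ (c * l).re) :
    closedNumericalRange A ⊆ convexHull ℝ S := by
  have hcpt : IsCompact (convexHull ℝ S) := hS.convexHull_of_finiteDimensional
  refine closure_minimal ?_ hcpt.isClosed
  rintro _ ⟨x, hx, rfl⟩
  by_contra hn
  obtain ⟨f, u, hf1, hf2⟩ :=
    geometric_hahn_banach_closed_point (convex_convexHull ℝ S) hcpt.isClosed hn
  -- Every real functional on `ℂ` is `z ↦ Re(c z)`, which turns the separating functional into a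
  -- direction `c`.
  have hf : ∀ z : ℂ, f z = (((f 1 : ℂ) - (f Complex.I : ℂ) * Complex.I) * z).re := by
    intro z
    have hz : z = z.re • (1 : ℂ) + z.im • Complex.I := by
      apply Complex.ext <;> simp
    conv_lhs => rw [hz]
    rw [map_add, map_smul, map_smul]
    simp
    ring
  obtain ⟨l, hl, hle⟩ := h ((f 1 : ℂ) - (f Complex.I : ℂ) * Complex.I)
  have h1 := hle x hx
  rw [← hf, ← hf] at h1
  have := hf1 l (subset_convexHull ℝ S hl)
  linarith

end NumericalRange

/-! ### Plane waves and the spectrum of Laurent limits -/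

section Tridiagonal

variable {H : Type*} [NormedAddCommGroup H] [InnerProductSpace ℂ H]

theorem HilbertBasis.norm_apply {ι : Type*} (e : HilbertBasis ι ℂ H) (i : ι) : ‖e i‖ = 1 :=
  e.orthonormal.1 i

/-- The `j`-th column of a tridiagonal operator. -/
theorem map_basis_of_mem_bandOperators {e : HilbertBasis ℤ ℂ H} {V : ℤ → Set ℂ}
    {A : H →L[ℂ] H} (hA : A ∈ bandOperators e (-1) 1 V) (j : ℤ) :
    A (e j) = matrixEntry e A (j + -1) j • e (j + -1) + matrixEntry e A (j + 0) j • e (j + 0)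
      + matrixEntry e A (j + 1) j • e (j + 1) := by
  have h1 := e.hasSum_repr (A (e j))
  have h2 : HasSum (fun i => e.repr (A (e j)) i • e i)
      (∑ i ∈ ({j + -1, j + 0, j + 1} : Finset ℤ), e.repr (A (e j)) i • e i) := by
    apply hasSum_sum_of_ne_finset_zero
    intro i hi
    have h3 := (hA j (i - j)).2
    rw [add_sub_cancel] at h3
    rw [e.repr_apply_apply]
    have h4 : inner ℂ (e i) (A (e j)) = (0 : ℂ) := h3 (by
      simp only [Finset.mem_insert, Finset.mem_singleton] at hi
      rw [Set.mem_Icc]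
      omega)
    rw [h4, zero_smul]
  rw [h1.unique h2, Finset.sum_insert (by simp), Finset.sum_insert (by simp),
    Finset.sum_singleton]
  simp only [e.repr_apply_apply, matrixEntry, add_assoc]

/-- Telescoping leaves only end terms: the truncation error of a plane wave stays bounded while its
norm grows like `√n`. -/
theorem norm_sum_sub_succ_le {E : Type*} [SeminormedAddCommGroup E] (f : ℕ → E)
    (hf : ∀ n, ‖f n‖ ≤ 1) (n : ℕ) : ‖∑ j ∈ Finset.range n, (f j - f (j + 1))‖ ≤ 2 := by
  rw [Finset.sum_range_sub']
  calc _ ≤ ‖f 0‖ + ‖f n‖ := norm_sub_le _ _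
    _ ≤ 2 := by linarith [hf 0, hf n]

theorem norm_sum_smul_basis (e : HilbertBasis ℤ ℂ H) {w : ℂ} (hw : ‖w‖ = 1) (m : ℤ) (n : ℕ) :
    ‖∑ j ∈ Finset.range n, w ^ j • e (m + j)‖ ^ 2 = n := by
  have h : Orthonormal ℂ (fun j : ℕ => e (m + (j : ℤ))) :=
    e.orthonormal.comp (fun j : ℕ => m + (j : ℤ)) (fun a b hab => by simpa using hab)
  have h2 := h.inner_sum (fun j => w ^ j) (fun j => w ^ j) (Finset.range n)
  have h3 : ∀ j : ℕ, (starRingEnd ℂ) (w ^ j) * w ^ j = 1 := by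
    intro j
    rw [← Complex.normSq_eq_conj_mul_self, Complex.normSq_eq_norm_sq]
    simp [hw]
  simp only [h3, Finset.sum_const, Finset.card_range] at h2
  rw [inner_self_eq_norm_sq_to_K] at h2
  have h4 : ((‖∑ j ∈ Finset.range n, w ^ j • e (m + j)‖ ^ 2 : ℝ) : ℂ) = ((n : ℝ) : ℂ) := by
    simpa using h2
  exact_mod_cast h4

/-- The symbol of the Laurent operator with diagonals `u (-1)`, `u 0`, `u 1`. -/
noncomputable def laurentSymbol (u : ℤ → ℂ) (w : ℂ) : ℂ := u (-1) * w + u 0 + u 1 * w⁻¹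

/-- Truncated plane waves are approximate eigenvectors wherever the tridiagonal operator is close
to a Laurent operator. -/
theorem norm_map_sub_laurentSymbol_smul_le {e : HilbertBasis ℤ ℂ H} {V : ℤ → Set ℂ}
    {A : H →L[ℂ] H} (hA : A ∈ bandOperators e (-1) 1 V) {u : ℤ → ℂ} {w : ℂ} (hw : ‖w‖ = 1)
    {m : ℤ} {n : ℕ} {ε : ℝ}
    (hm : ∀ j ∈ Set.Ico m (m + n), ∀ k ∈ Set.Icc (-1 : ℤ) 1,
      ‖matrixEntry e A (j + k) j - u k‖ ≤ ε) :
    ‖A (∑ j ∈ Finset.range n, w ^ j • e (m + j)) -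
      laurentSymbol u w • ∑ j ∈ Finset.range n, w ^ j • e (m + j)‖ ≤
      n * (3 * ε) + (2 * ‖u (-1)‖ + 2 * ‖u 1‖) := by
  have hw0 : w ≠ 0 := by
    rintro rfl
    simp at hw
  set f : ℕ → H := fun j => w ^ j • e (m + j + -1) with hf
  set g : ℕ → H := fun j => (w⁻¹ * w ^ j) • e (m + j) with hg
  set r : ℕ → H := fun j => w ^ j •
    ((matrixEntry e A (m + j + -1) (m + j) - u (-1)) • e (m + j + -1)
      + (matrixEntry e A (m + j + 0) (m + j) - u 0) • e (m + j + 0)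
      + (matrixEntry e A (m + j + 1) (m + j) - u 1) • e (m + j + 1)) with hr
  -- `r` collects the deviation of the entries from `u`; the exact Laurent part is an eigenvector
  -- equation up to telescoping ends, one for each side diagonal.
  have key : A (∑ j ∈ Finset.range n, w ^ j • e (m + j)) -
      laurentSymbol u w • ∑ j ∈ Finset.range n, w ^ j • e (m + j) =
      ∑ j ∈ Finset.range n, r j + (u (-1) • ∑ j ∈ Finset.range n, (f j - f (j + 1))
        - u 1 • ∑ j ∈ Finset.range n, (g j - g (j + 1))) := by
    rw [map_sum, Finset.smul_sum, Finset.smul_sum, Finset.smul_sum, ← Finset.sum_sub_distrib,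
      ← Finset.sum_sub_distrib, ← Finset.sum_add_distrib]
    refine Finset.sum_congr rfl fun j _ => ?_
    have e1 : m + ((j + 1 : ℕ) : ℤ) + -1 = m + j := by push_cast; ring
    have e2 : m + ((j + 1 : ℕ) : ℤ) = m + j + 1 := by push_cast; ring
    simp only [hf, hg, hr, laurentSymbol]
    rw [map_smul, map_basis_of_mem_bandOperators hA, e1, e2, add_zero, pow_succ,
      show w⁻¹ * (w ^ j * w) = w ^ j by field_simp]
    module
  have hwj : ∀ j : ℕ, ‖w ^ j‖ = 1 := fun j => by rw [norm_pow, hw, one_pow]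
  have hfn : ∀ j, ‖f j‖ ≤ 1 := fun j => by rw [norm_smul, hwj, e.norm_apply, one_mul]
  have hgn : ∀ j, ‖g j‖ ≤ 1 := fun j => by
    rw [norm_smul, norm_mul, norm_inv, hw, hwj, e.norm_apply]; norm_num
  have hrn : ∀ j ∈ Finset.range n, ‖r j‖ ≤ 3 * ε := by
    intro j hj
    have hj' : m + (j : ℤ) ∈ Set.Ico m (m + n) := by
      rw [Finset.mem_range] at hj
      constructor <;> omega
    rw [norm_smul, hwj, one_mul]
    refine norm_add₃_le.trans ?_
    rw [norm_smul, norm_smul, norm_smul, e.norm_apply, e.norm_apply, e.norm_apply]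
    have h1 := hm _ hj' (-1) (by simp)
    have h2 := hm _ hj' 0 (by simp)
    have h3 := hm _ hj' 1 (by simp)
    linarith
  rw [key]
  refine (norm_add_le _ _).trans (add_le_add ?_ ?_)
  · refine (norm_sum_le_of_le _ hrn).trans ?_
    simp
  · refine (norm_sub_le _ _).trans (add_le_add ?_ ?_)
    · rw [norm_smul, mul_comm]
      exact mul_le_mul_of_nonneg_right (norm_sum_sub_succ_le f hfn n) (norm_nonneg _)
    · rw [norm_smul, mul_comm]
      exact mul_le_mul_of_nonneg_right (norm_sum_sub_succ_le g hgn n) (norm_nonneg _)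

/-- If `A` is arbitrarily close to a Laurent operator on arbitrarily long windows, then its spectrum
contains that of the Laurent operator. -/
theorem laurentSymbol_mem_spectrum {e : HilbertBasis ℤ ℂ H} {V : ℤ → Set ℂ}
    {A : H →L[ℂ] H} (hA : A ∈ bandOperators e (-1) 1 V) {u : ℤ → ℂ}
    (hu : ∀ (n : ℕ) (ε : ℝ), 0 < ε → ∃ m : ℤ, ∀ j ∈ Set.Ico m (m + n),
      ∀ k ∈ Set.Icc (-1 : ℤ) 1, ‖matrixEntry e A (j + k) j - u k‖ ≤ ε)
    {w : ℂ} (hw : ‖w‖ = 1) : laurentSymbol u w ∈ spectrum ℂ A := by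
  rintro ⟨T, hT⟩
  set l := laurentSymbol u w with hl
  set R : H →L[ℂ] H := ((T⁻¹ : (H →L[ℂ] H)ˣ) : H →L[ℂ] H) with hR
  have hinv : ∀ x, R (l • x - A x) = x := by
    intro x
    have h1 : R * (T : H →L[ℂ] H) = 1 := T.inv_mul
    have h2 := congrArg (fun S : H →L[ℂ] H => S x) h1
    rw [hT] at h2
    simpa [Algebra.algebraMap_eq_smul_one] using h2
  set K := 2 * ‖u (-1)‖ + 2 * ‖u 1‖ with hK
  -- With tolerance `1 / n` the residual is at most `3 + K`, so a bounded inverse `R` would force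
  -- `√n ≤ ‖R‖ (3 + K)`.
  obtain ⟨n, hn⟩ := exists_nat_gt ((‖R‖ * (3 + K)) ^ 2)
  have hn0 : 0 < (n : ℝ) := lt_of_le_of_lt (sq_nonneg _) hn
  obtain ⟨m, hm⟩ := hu n (1 / n) (by positivity)
  set x := ∑ j ∈ Finset.range n, w ^ j • e (m + j) with hx
  have h1 := norm_map_sub_laurentSymbol_smul_le hA hw hm
  rw [← hx, ← hl, ← hK, show (n : ℝ) * (3 * (1 / n)) = 3 by field_simp] at h1
  have h2 : ‖x‖ ≤ ‖R‖ * (3 + K) := by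
    calc ‖x‖ = ‖R (l • x - A x)‖ := by rw [hinv]
      _ ≤ ‖R‖ * ‖l • x - A x‖ := R.le_opNorm _
      _ ≤ ‖R‖ * (3 + K) := by
        rw [norm_sub_rev]
        exact mul_le_mul_of_nonneg_left h1 (norm_nonneg _)
  have h3 := norm_sum_smul_basis e hw m n
  rw [← hx] at h3
  have h4 := pow_le_pow_left₀ (norm_nonneg x) h2 2
  linarith

end Tridiagonal

/-! ### The sharp bound on the form and the deterministic equality -/

section Tridiagonal

variable {H : Type*} [NormedAddCommGroup H] [InnerProductSpace ℂ H]

/-- The `i`-th coordinate of the image of a vector under a tridiagonal operator. -/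
theorem inner_basis_map_of_mem_bandOperators {e : HilbertBasis ℤ ℂ H} {V : ℤ → Set ℂ}
    {A : H →L[ℂ] H} (hA : A ∈ bandOperators e (-1) 1 V) (x : H) (i : ℤ) :
    inner ℂ (e i) (A x) = matrixEntry e A i (i - 1) * inner ℂ (e (i - 1)) x
      + matrixEntry e A i i * inner ℂ (e i) x
      + matrixEntry e A i (i + 1) * inner ℂ (e (i + 1)) x := by
  have h1 : HasSum (fun j => matrixEntry e A i j * inner ℂ (e j) x) (inner ℂ (e i) (A x)) := by
    convert! ((e.hasSum_repr x).mapL A).mapL (innerSL ℂ (e i)) using 1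
    ext j
    rw [map_smul, innerSL_apply_apply, inner_smul_right, e.repr_apply_apply, mul_comm, matrixEntry]
  have h2 : HasSum (fun j => matrixEntry e A i j * inner ℂ (e j) x)
      (∑ j ∈ ({i - 1, i, i + 1} : Finset ℤ), matrixEntry e A i j * inner ℂ (e j) x) := by
    apply hasSum_sum_of_ne_finset_zero
    intro j hj
    have h3 := (hA j (i - j)).2
    rw [add_sub_cancel] at h3
    rw [h3, zero_mul]
    simp only [Finset.mem_insert, Finset.mem_singleton] at hj
    rw [Set.mem_Icc]
    omega
  rw [h1.unique h2, Finset.sum_insert (by simp; omega), Finset.sum_insert (by simp),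
    Finset.sum_singleton, add_assoc]

theorem norm_matrixEntry_le (e : HilbertBasis ℤ ℂ H) (A : H →L[ℂ] H) (i j : ℤ) :
    ‖matrixEntry e A i j‖ ≤ ‖A‖ := by
  refine (norm_inner_le_norm _ _).trans ?_
  rw [e.norm_apply, one_mul]
  simpa [e.norm_apply] using A.le_opNorm (e j)

theorem HilbertBasis.hasSum_sq_norm_inner {ι : Type*} (e : HilbertBasis ι ℂ H) (x : H) :
    HasSum (fun i => ‖inner ℂ (e i) x‖ ^ 2) (‖x‖ ^ 2) := by
  rw [← Complex.hasSum_ofReal]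
  convert! e.hasSum_inner_mul_inner x x using 1
  · ext i
    rw [← inner_conj_symm x, ← Complex.normSq_eq_conj_mul_self, Complex.normSq_eq_norm_sq]
  · rw [inner_self_eq_norm_sq_to_K]
    simp

/-- Conjugating one side term inside the real part merges both into `conj Y * X * (c b' + conj (c
b))`; then `2 ‖X‖ ‖Y‖ ≤ ‖X‖ ^ 2 + ‖Y‖ ^ 2`. -/
theorem re_tridiagonal_form_le {c a b b' : ℂ} {α ρ : ℝ} (X Y : ℂ) (hd : (c * a).re ≤ α)
    (hs : ‖c * b' + (starRingEnd ℂ) (c * b)‖ ≤ ρ) :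
    (c * ((starRingEnd ℂ) Y * (b' * X))).re + (c * ((starRingEnd ℂ) X * (a * X))).re
      + (c * ((starRingEnd ℂ) X * (b * Y))).re ≤
      α * ‖X‖ ^ 2 + ρ / 2 * (‖X‖ ^ 2 + ‖Y‖ ^ 2) := by
  have h1 : (c * ((starRingEnd ℂ) X * (a * X))).re = (c * a).re * ‖X‖ ^ 2 := by
    have : c * ((starRingEnd ℂ) X * (a * X)) = (c * a) * ((‖X‖ ^ 2 : ℝ) : ℂ) := by
      rw [← Complex.normSq_eq_norm_sq, Complex.normSq_eq_conj_mul_self]; ring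
    rw [this, Complex.re_mul_ofReal]
  have h2 : (c * ((starRingEnd ℂ) X * (b * Y))).re
      = ((starRingEnd ℂ) Y * X * (starRingEnd ℂ) (c * b)).re := by
    rw [← Complex.conj_re]
    simp only [map_mul, Complex.conj_conj]
    ring_nf
  have h3 : (c * ((starRingEnd ℂ) Y * (b' * X))).re + (c * ((starRingEnd ℂ) X * (b * Y))).re
      ≤ ρ / 2 * (‖X‖ ^ 2 + ‖Y‖ ^ 2) := by
    rw [h2, ← Complex.add_re]
    calc _ = ((starRingEnd ℂ) Y * X * (c * b' + (starRingEnd ℂ) (c * b))).re := by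
          congr 1; ring
      _ ≤ ‖Y‖ * ‖X‖ * ‖c * b' + (starRingEnd ℂ) (c * b)‖ := by
          refine (Complex.re_le_norm _).trans_eq ?_
          rw [norm_mul, norm_mul, RCLike.norm_conj]
      _ ≤ ‖Y‖ * ‖X‖ * ρ := mul_le_mul_of_nonneg_left hs (by positivity)
      _ ≤ _ := by
          nlinarith [mul_nonneg ((norm_nonneg _).trans hs) (sq_nonneg (‖X‖ - ‖Y‖))]
  have h4 := mul_le_mul_of_nonneg_right hd (sq_nonneg ‖X‖)
  rw [h1]
  linarith

/-- The real part of a tridiagonal form is bounded by the maximum on the main diagonal plus that of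
the modulus of the symmetrised side diagonals. -/
theorem re_mul_inner_map_le {e : HilbertBasis ℤ ℂ H} {V : ℤ → Set ℂ}
    {A : H →L[ℂ] H} (hA : A ∈ bandOperators e (-1) 1 V) {c : ℂ} {α ρ : ℝ}
    (hα : ∀ z ∈ V 0, (c * z).re ≤ α)
    (hρ : ∀ y ∈ V 1, ∀ z ∈ V (-1), ‖c * y + (starRingEnd ℂ) (c * z)‖ ≤ ρ) (x : H) :
    (c * inner ℂ x (A x)).re ≤ (α + ρ) * ‖x‖ ^ 2 := by
  obtain ⟨X, hX⟩ : ∃ X : ℤ → ℂ, X = fun i => inner ℂ (e i) x := ⟨_, rfl⟩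
  obtain ⟨p, hp⟩ : ∃ p : ℤ → ℝ, p = fun i => (c * ((starRingEnd ℂ) (X (i + 1)) *
    (matrixEntry e A (i + 1) i * X i))).re := ⟨_, rfl⟩
  have hX2 : HasSum (fun i => ‖X i‖ ^ 2) (‖x‖ ^ 2) := by
    rw [hX]
    exact e.hasSum_sq_norm_inner x
  have hX2' : HasSum (fun i => ‖X (i + 1)‖ ^ 2) (‖x‖ ^ 2) :=
    (Equiv.addRight (1 : ℤ)).hasSum_iff (f := fun i => ‖X i‖ ^ 2) |>.2 hX2
  have hps : Summable p := by
    refine Summable.of_norm_bounded (g := fun i => ‖c‖ * ‖A‖ * (‖X i‖ ^ 2 + ‖X (i + 1)‖ ^ 2))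
      ((hX2.summable.add hX2'.summable).mul_left _) fun i => ?_
    rw [hp, Real.norm_eq_abs]
    refine (Complex.abs_re_le_norm _).trans ?_
    rw [norm_mul, norm_mul, norm_mul, RCLike.norm_conj, mul_assoc]
    refine mul_le_mul_of_nonneg_left ?_ (norm_nonneg _)
    have h1 := norm_matrixEntry_le e A (i + 1) i
    calc ‖X (i + 1)‖ * (‖matrixEntry e A (i + 1) i‖ * ‖X i‖)
        = ‖matrixEntry e A (i + 1) i‖ * (‖X i‖ * ‖X (i + 1)‖) := by ring
      _ ≤ ‖A‖ * (‖X i‖ ^ 2 + ‖X (i + 1)‖ ^ 2) := by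
        refine mul_le_mul h1 ?_ (by positivity) (norm_nonneg _)
        nlinarith [sq_nonneg (‖X i‖ - ‖X (i + 1)‖), sq_nonneg ‖X i‖, sq_nonneg ‖X (i + 1)‖]
  have hp1 : HasSum (fun i => p (i - 1)) (∑' i, p i) :=
    (Equiv.subRight (1 : ℤ)).hasSum_iff (f := p) |>.2 hps.hasSum
  have hsum : HasSum (fun i => (c * ((starRingEnd ℂ) (X i) * inner ℂ (e i) (A x))).re)
      (c * inner ℂ x (A x)).re := by
    convert! Complex.hasSum_re ((e.hasSum_inner_mul_inner x (A x)).mul_left c) using 1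
    ext i
    rw [hX, inner_conj_symm]
  -- Adding `p i - p (i - 1)`, of total sum zero, regroups rows so that the `i`-th summand holds
  -- both terms coupling `i` and `i + 1`.
  have hL := hsum.add (hps.hasSum.sub hp1)
  have hR := (hX2.mul_left α).add ((hX2.add hX2').mul_left (ρ / 2))
  have hle := hasSum_le (fun i => ?_) hL hR
  · linarith
  have hd := hα _ (by simpa using (hA i 0).1 (by simp))
  have hs := hρ _ ((hA i 1).1 (by simp)) (matrixEntry e A i (i + 1)) (by
    simpa using (hA (i + 1) (-1)).1 (by simp))
  have hpt := re_tridiagonal_form_le (X i) (X (i + 1)) hd hs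
  rw [inner_basis_map_of_mem_bandOperators hA, mul_add, mul_add, mul_add, mul_add, Complex.add_re,
    Complex.add_re]
  simp only [hp, sub_add_cancel]
  simp only [hX] at hpt ⊢
  linarith

/-- The closed numerical range of a tridiagonal operator which has every Laurent operator over `V`
as a limit is the convex hull of the spectrum. -/
theorem closedNumericalRange_eq_convexHull_spectrum [CompleteSpace H] {e : HilbertBasis ℤ ℂ H}
    {V : ℤ → Set ℂ} (hV : ∀ k ∈ Set.Icc (-1 : ℤ) 1, (V k).Nonempty ∧ IsCompact (V k))
    {A : H →L[ℂ] H} (hA : A ∈ bandOperators e (-1) 1 V)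
    (hwin : ∀ u : ℤ → ℂ, (∀ k ∈ Set.Icc (-1 : ℤ) 1, u k ∈ V k) → ∀ (n : ℕ) (ε : ℝ), 0 < ε →
      ∃ m : ℤ, ∀ j ∈ Set.Ico m (m + n), ∀ k ∈ Set.Icc (-1 : ℤ) 1,
        ‖matrixEntry e A (j + k) j - u k‖ ≤ ε) :
    closedNumericalRange A = convexHull ℝ (spectrum ℂ A) := by
  refine (closedNumericalRange_subset_convexHull (spectrum.isCompact A) fun c => ?_).antisymm
    (convexHull_spectrum_subset_closedNumericalRange A)
  obtain ⟨hn0, hc0⟩ := hV 0 (by simp)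
  obtain ⟨hn1, hc1⟩ := hV 1 (by simp)
  obtain ⟨hn2, hc2⟩ := hV (-1) (by simp)
  obtain ⟨u0, hu0, hmax0⟩ := hc0.exists_isMaxOn hn0
    (f := fun z => (c * z).re) (by fun_prop)
  obtain ⟨⟨u1, u2⟩, ⟨hu1, hu2⟩, hmax1⟩ := (hc1.prod hc2).exists_isMaxOn (hn1.prod hn2)
    (f := fun q : ℂ × ℂ => ‖c * q.1 + (starRingEnd ℂ) (c * q.2)‖)
    (by apply Continuous.continuousOn; fun_prop)
  set v := c * u1 + (starRingEnd ℂ) (c * u2) with hv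
  -- The frequency `w` aligns the side-diagonal part of the symbol with direction `c`, attaining `ρ
  -- = ‖v‖`.
  obtain ⟨w, hw, hwv⟩ : ∃ w : ℂ, ‖w‖ = 1 ∧ (w⁻¹ * v).re = ‖v‖ := by
    by_cases h0 : v = 0
    · exact ⟨1, by simp, by simp [h0]⟩
    · have h0' : (‖v‖ : ℂ) ≠ 0 := by simpa using h0
      refine ⟨v / ‖v‖, by simp [h0], ?_⟩
      rw [inv_div, div_mul_cancel₀ _ h0, Complex.ofReal_re]
  have hwc : (starRingEnd ℂ) w = w⁻¹ := by
    rw [Complex.inv_def, Complex.normSq_eq_norm_sq, hw]; simp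
  set u : ℤ → ℂ := fun k => if k = 0 then u0 else if k = 1 then u1 else u2 with hu
  have huV : ∀ k ∈ Set.Icc (-1 : ℤ) 1, u k ∈ V k := by
    rintro k ⟨hk1, hk2⟩
    interval_cases k
    · simpa [hu] using hu2
    · simpa [hu] using hu0
    · simpa [hu] using hu1
  refine ⟨laurentSymbol u w, laurentSymbol_mem_spectrum hA (hwin u huV) hw, fun x hx => ?_⟩
  refine (re_mul_inner_map_le hA (α := (c * u0).re) (ρ := ‖v‖) (fun z hz => hmax0 hz)
    (fun y hy z hz => hmax1 (Set.mk_mem_prod hy hz)) x).trans_eq ?_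
  have h1 : c * laurentSymbol u w = c * u0 + (c * u2 * w + w⁻¹ * (c * u1)) := by
    simp [laurentSymbol, hu]; ring
  have h2 : (c * u2 * w).re = (w⁻¹ * (starRingEnd ℂ) (c * u2)).re := by
    rw [← Complex.conj_re, map_mul, hwc, mul_comm]
  rw [h1, Complex.add_re, Complex.add_re, h2, ← Complex.add_re, ← mul_add,
    add_comm ((starRingEnd ℂ) (c * u2)), ← hv, hwv, hx]
  ring

theorem norm_entry_le_norm_toEuclideanCLM {d : ℕ} (M : Matrix (Fin d) (Fin d) ℂ) (a b : Fin d) :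
    ‖M a b‖ ≤ ‖Matrix.toEuclideanCLM (𝕜 := ℂ) M‖ := by
  have h1 : (Matrix.toEuclideanCLM (𝕜 := ℂ) M (EuclideanSpace.single b 1)) a = M a b := by
    rw [Matrix.ofLp_toEuclideanCLM]
    simp
  rw [← h1]
  refine (PiLp.norm_apply_le _ a).trans ?_
  simpa using (Matrix.toEuclideanCLM (𝕜 := ℂ) M).le_opNorm (EuclideanSpace.single b 1)

/-- Pseudo-ergodic tridiagonal operators have every Laurent operator as a limit. -/
theorem exists_window_of_mem_pseudoErgodicOperators {e : HilbertBasis ℤ ℂ H} {U : ℤ → Set ℂ}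
    {A : H →L[ℂ] H} (hA : A ∈ pseudoErgodicOperators e (-1) 1 U) {u : ℤ → ℂ}
    (hu : ∀ k ∈ Set.Icc (-1 : ℤ) 1, u k ∈ U k) (n : ℕ) {ε : ℝ} (hε : 0 < ε) :
    ∃ m : ℤ, ∀ j ∈ Set.Ico m (m + n), ∀ k ∈ Set.Icc (-1 : ℤ) 1,
      ‖matrixEntry e A (j + k) j - u k‖ ≤ ε := by
  classical
  -- One extra index on each side, so that all `n` inner columns have their three entries in the
  -- block; hence the window starts at `m + 1`.
  set B : Matrix (Fin (n + 2)) (Fin (n + 2)) ℂ := Matrix.of fun a b =>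
    if (a : ℤ) - (b : ℤ) ∈ Set.Icc (-1 : ℤ) 1 then u ((a : ℤ) - (b : ℤ)) else 0 with hB
  obtain ⟨m, hm⟩ := hA.2 ε hε (n + 2) B fun a b =>
    ⟨fun h => by simpa only [hB, Matrix.of_apply, if_pos h] using hu _ h,
      fun h => by simp only [hB, Matrix.of_apply, if_neg h]⟩
  refine ⟨m + 1, fun j hj k hk => ?_⟩
  obtain ⟨hj1, hj2⟩ := hj
  have hk' := hk
  obtain ⟨hk1, hk2⟩ := hk
  have ha : (((⟨(j + k - m).toNat, by omega⟩ : Fin (n + 2)) : ℕ) : ℤ) = j + k - m := by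
    simp; omega
  have hb : (((⟨(j - m).toNat, by omega⟩ : Fin (n + 2)) : ℕ) : ℤ) = j - m := by
    simp; omega
  refine le_trans (le_of_eq ?_) ((norm_entry_le_norm_toEuclideanCLM _
    ⟨(j + k - m).toNat, by omega⟩ ⟨(j - m).toNat, by omega⟩).trans hm)
  rw [Matrix.sub_apply, finiteSection, hB, Matrix.of_apply, Matrix.of_apply, ha, hb,
    show j + k - m - (j - m) = k by ring, if_pos hk', add_sub_cancel, add_sub_cancel]

end Tridiagonal

/-! ### A non-normal pseudo-ergodic shift -/

section WeightedShift

/-- There is a two-sided binary sequence that contains every finite binary word. -/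
theorem exists_universal_binary_sequence :
    ∃ w : ℤ → Bool, ∀ (d : ℕ) (f : Fin d → Bool), ∃ k : ℤ, ∀ a : Fin d, w (k + (a : ℤ)) = f a := by
  -- A word of length `d`, coded as `s = pair bits d`, is written from position `s ^ 2` on. It fits
  -- before `(s + 1) ^ 2` because `d ≤ s`, and `Nat.sqrt` recovers `s`.
  refine ⟨fun i => (Nat.unpair (Nat.sqrt i.toNat)).1.testBit
    (i.toNat - Nat.sqrt i.toNat * Nat.sqrt i.toNat), fun d f => ?_⟩
  set s := Nat.pair (Nat.ofBits f) d with hs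
  refine ⟨((s * s : ℕ) : ℤ), fun a => ?_⟩
  have h1 : (((s * s : ℕ) : ℤ) + (a : ℤ)).toNat = s * s + a := by omega
  have h2 : d ≤ s := Nat.right_le_pair _ _
  have h3 : Nat.sqrt (s * s + a) = s := Nat.sqrt_add_eq s (by omega)
  simp only [h1, h3, Nat.add_sub_cancel_left]
  rw [hs, Nat.unpair_pair, Nat.testBit_ofBits_lt _ _ a.2]

variable {H : Type*} [NormedAddCommGroup H] [InnerProductSpace ℂ H]

/-- The bilateral shift with weights in `{0, 1}`. -/
theorem exists_weighted_shift [CompleteSpace H] (e : HilbertBasis ℤ ℂ H) (w : ℤ → Bool) :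
    ∃ A : H →L[ℂ] H, ∀ i, A (e i) = if w i then e (i + 1) else 0 := by
  classical
  have hon : Orthonormal ℂ fun i : ℤ => e (i + 1) :=
    e.orthonormal.comp (fun i : ℤ => i + 1) (add_left_injective 1)
  have hrange : Set.range (fun i : ℤ => e (i + 1)) = Set.range e :=
    (Equiv.addRight (1 : ℤ)).surjective.range_comp e
  set e' : HilbertBasis ℤ ℂ H := HilbertBasis.mk hon (by rw [hrange, e.dense_span]) with he'
  set S : H →L[ℂ] H := ((e.repr.trans e'.repr.symm : H ≃ₗᵢ[ℂ] H) : H →L[ℂ] H) with hS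
  have hSe : ∀ i, S (e i) = e (i + 1) := by
    intro i
    have h1 : S (e i) = e'.repr.symm (e.repr (e i)) := rfl
    rw [h1, e.repr_self, e'.repr_symm_single, he', HilbertBasis.coe_mk]
  set K : Submodule ℂ H := (Submodule.span ℂ (e '' {i | w i})).topologicalClosure with hK
  have : CompleteSpace K := (Submodule.isClosed_topologicalClosure _).completeSpace_coe
  -- First project onto the closed span of the `e i` of weight 1, then shift.
  refine ⟨S.comp K.starProjection, fun i => ?_⟩
  rw [ContinuousLinearMap.comp_apply]
  split_ifs with hi
  · rw [Submodule.starProjection_eq_self_iff.2, hSe]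
    exact Submodule.le_topologicalClosure _ (Submodule.subset_span ⟨i, hi, rfl⟩)
  · rw [(Submodule.starProjection_apply_eq_zero_iff K).2, map_zero]
    rw [hK, Submodule.orthogonal_closure]
    rw [Submodule.mem_orthogonal]
    intro v hv
    induction hv using Submodule.span_induction with
    | mem x hx =>
      obtain ⟨j, hj, rfl⟩ := hx
      refine e.orthonormal.2 fun hji => hi ?_
      rw [← hji]; exact hj
    | zero => simp
    | add x y _ _ hx hy => rw [inner_add_left, hx, hy, add_zero]
    | smul a x _ hx => rw [inner_smul_left, hx, mul_zero]

/-- With only the subdiagonal free in `{0, 1}`, finite patterns are binary words and occur exactly.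
The word `10` gives `A e_k = e_{k+1}` and `A e_{k+1} = 0`; normality would force the adjoint to kill
`e_{k+1}` too. -/
theorem exists_pseudoErgodic_not_isStarNormal [CompleteSpace H] (e : HilbertBasis ℤ ℂ H) :
    ∃ U : ℤ → Set ℂ, (∀ k ∈ Set.Icc (-1 : ℤ) 1, (U k).Nonempty ∧ IsCompact (U k)) ∧
      ∃ A ∈ pseudoErgodicOperators e (-1) 1 U, ¬ IsStarNormal A := by
  classical
  obtain ⟨w, hw⟩ := exists_universal_binary_sequence
  obtain ⟨A, hA⟩ := exists_weighted_shift e w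
  have hent : ∀ i j : ℤ, matrixEntry e A i j = if i = j + 1 ∧ w j then 1 else 0 := by
    intro i j
    rw [matrixEntry, hA]
    by_cases hj : w j
    · simp [hj, orthonormal_iff_ite.1 e.orthonormal]
    · simp [hj]
  refine ⟨fun k => if k = 1 then {0, 1} else {0}, fun k _ => ?_, A, ⟨fun i k => ?_, ?_⟩, ?_⟩
  · dsimp only
    split_ifs
    · exact ⟨⟨0, by simp⟩, (Set.toFinite _).isCompact⟩
    · exact ⟨⟨0, by simp⟩, isCompact_singleton⟩
  · rw [hent]
    by_cases hk : k = 1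
    · subst hk
      refine ⟨fun _ => ?_, fun h => absurd (by simp) h⟩
      by_cases hi : w i <;> simp [hi]
    · simp [hk]
  · intro ε hε d B hB
    -- The last column has no subdiagonal entry inside the block; its letter defaults to `false`.
    obtain ⟨k, hk⟩ := hw d fun b => decide (∃ a : Fin d, (a : ℤ) = b + 1 ∧ B a b = 1)
    refine ⟨k, ?_⟩
    have : finiteSection e A k d = B := by
      ext a b
      rw [finiteSection, Matrix.of_apply, hent, hk]
      obtain ⟨h1, h2⟩ := hB a b
      by_cases hab : (a : ℤ) = b + 1
      · have h3 := h1 (by rw [hab]; simp)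
        rw [hab] at h3
        simp only [add_sub_cancel_left, if_true, Set.mem_insert_iff, Set.mem_singleton_iff] at h3
        have h4 : (∃ a' : Fin d, (a' : ℤ) = b + 1 ∧ B a' b = 1) ↔ B a b = 1 := by
          constructor
          · rintro ⟨a', ha', h⟩
            have : a' = a := Fin.ext (by omega)
            rwa [← this]
          · exact fun h => ⟨a, hab, h⟩
        rcases h3 with h3 | h3 <;> simp [hab, h4, h3, add_assoc]
      · rw [if_neg (by rintro ⟨h, -⟩; exact hab (by linarith))]
        by_cases hm : (a : ℤ) - b ∈ Set.Icc (-1 : ℤ) 1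
        · have h3 := h1 hm
          simp only [show (a : ℤ) - b ≠ 1 by omega, if_false] at h3
          exact (Set.mem_singleton_iff.1 h3).symm
        · exact (h2 hm).symm
    rw [this, sub_self, map_zero, norm_zero]
    exact hε.le
  · intro hn
    obtain ⟨k, hk⟩ := hw 2 ![true, false]
    have h0 : w k = true := by simpa using hk 0
    have h1 : w (k + 1) = false := by simpa using hk 1
    have h2 := (ContinuousLinearMap.isStarNormal_iff_norm_eq_adjoint.1 hn) (e (k + 1))
    rw [hA, h1] at h2
    have h3 : ContinuousLinearMap.adjoint A (e (k + 1)) = 0 := by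
      rw [← norm_eq_zero, ← h2]; simp
    have h4 : inner ℂ (ContinuousLinearMap.adjoint A (e (k + 1))) (e k) = (1 : ℂ) := by
      rw [ContinuousLinearMap.adjoint_inner_left, hA, h0]
      simp [e.norm_apply]
    rw [h3, inner_zero_left] at h4
    exact zero_ne_one h4

end WeightedShift

/-! ### Random operators: windows by Borel–Cantelli -/

section Probability

/-- In independent families, indexed by `κ × ℤ` and identically distributed in the second index,
every pattern of positive probability occurs almost surely on some window of given length. -/
theorem ae_exists_window {Ω κ 𝓧 : Type*} [MeasurableSpace Ω] [MeasurableSpace 𝓧] [Fintype κ]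
    {P : Measure Ω} [IsProbabilityMeasure P] {X : κ × ℤ → Ω → 𝓧} {μ : κ → Measure 𝓧}
    (hlaw : ∀ p : κ × ℤ, HasLaw (X p) (μ p.1) P) (hind : iIndepFun X P)
    {B : κ → Set 𝓧} (hB : ∀ k, MeasurableSet (B k)) (hpos : ∀ k, μ k (B k) ≠ 0) (n : ℕ) :
    ∀ᵐ ω ∂P, ∃ m : ℤ, ∀ j ∈ Set.Ico m (m + n), ∀ k, X (k, j) ω ∈ B k := by
  classical
  set Y : κ × ℤ → Ω → 𝓧 := fun p => (hlaw p).aemeasurable.mk (X p) with hY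
  have hXY : ∀ p, X p =ᵐ[P] Y p := fun p => (hlaw p).aemeasurable.ae_eq_mk
  have hYm : ∀ p, Measurable (Y p) := fun p => (hlaw p).aemeasurable.measurable_mk
  have hYind : iIndepFun Y P := hind.congr hXY
  have hYlaw : ∀ p, P (Y p ⁻¹' B p.1) = μ p.1 (B p.1) := fun p => by
    rw [← (hlaw p).map_eq, Measure.map_congr (hXY p), Measure.map_apply (hYm p) (hB _)]
  -- Disjoint blocks give independent events of equal positive probability, so the second
  -- Borel–Cantelli lemma applies.
  set S : ℕ → Finset (κ × ℤ) := fun r =>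
    Finset.univ ×ˢ Finset.Ico ((r : ℤ) * n) (r * n + n) with hS
  have hSd : ∀ r s, r ≠ s → Disjoint (S r) (S s) := by
    intro r s hrs
    rw [Finset.disjoint_left]
    rintro ⟨k, j⟩ h1 h2
    simp only [hS, Finset.mem_product, Finset.mem_Ico, Finset.mem_univ, true_and] at h1 h2
    have h3 : (r : ℤ) * n < (s + 1) * n := by linarith
    have h4 : (s : ℤ) * n < (r + 1) * n := by linarith
    have h5 := lt_of_mul_lt_mul_right h3 (by positivity)
    have h6 := lt_of_mul_lt_mul_right h4 (by positivity)
    omega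
  set E : ℕ → Set Ω := fun r => ⋂ p ∈ S r, Y p ⁻¹' B p.1 with hE
  have hEm : ∀ r, MeasurableSet (E r) := fun r =>
    Finset.measurableSet_biInter _ fun p _ => hYm p (hB _)
  have hEP : ∀ r, P (E r) = ∏ k, μ k (B k) ^ n := by
    intro r
    rw [hE, hYind.measure_inter_preimage_eq_mul (S r) (fun p _ => hB p.1)]
    simp only [hYlaw]
    rw [hS, Finset.prod_product]
    simp
  have hEi : iIndepSet E P := by
    rw [iIndepSet_iff_meas_biInter hEm]
    intro s
    have h1 : ⋂ r ∈ s, E r = ⋂ p ∈ s.biUnion S, Y p ⁻¹' B p.1 := by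
      rw [Finset.set_biInter_biUnion]
    rw [h1, hYind.measure_inter_preimage_eq_mul (s.biUnion S) (fun p _ => hB p.1),
      Finset.prod_biUnion fun r _ t _ hrt => hSd r t hrt]
    refine Finset.prod_congr rfl fun r _ => ?_
    rw [hE, hYind.measure_inter_preimage_eq_mul (S r) (fun p _ => hB p.1)]
  have hEsum : ∑' r, P (E r) = ⊤ := by
    simp only [hEP]
    refine ENNReal.tsum_const_eq_top_of_ne_zero ?_
    exact Finset.prod_ne_zero_iff.2 fun k _ => pow_ne_zero _ (hpos k)
  have hlim := measure_limsup_eq_one hEm hEi hEsum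
  have hlim' : ∀ᵐ ω ∂P, ω ∈ Filter.limsup E Filter.atTop :=
    (prob_compl_eq_zero_iff (.measurableSet_limsup hEm)).2 hlim
  filter_upwards [hlim', ae_all_iff.2 hXY] with ω h1 h2
  rw [Filter.mem_limsup_iff_frequently_mem] at h1
  obtain ⟨r, hr⟩ := h1.exists
  refine ⟨(r : ℤ) * n, fun j hj k => ?_⟩
  rw [h2]
  simp only [hE, Set.mem_iInter] at hr
  exact hr (k, j) (by simpa [hS] using hj)

variable {H : Type*} [NormedAddCommGroup H] [InnerProductSpace ℂ H]

/-- A random band operator with laws `μ k` almost surely contains approximations to all constant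
diagonals in the supports of the laws, on arbitrarily long windows. -/
theorem ae_exists_window_of_isRandomBandOperator {Ω : Type*} [MeasurableSpace Ω] {P : Measure Ω}
    [IsProbabilityMeasure P] {e : HilbertBasis ℤ ℂ H} {n m : ℤ} {U : ℤ → Set ℂ}
    {A : Ω → (H →L[ℂ] H)} (hA : IsRandomBandOperator P e n m U A) {μ : ℤ → Measure ℂ}
    (hμ : ∀ k ∈ Set.Icc n m, ∀ i : ℤ, HasLaw (fun ω => matrixEntry e (A ω) (i + k) i) (μ k) P) :
    ∀ᵐ ω ∂P, ∀ u : ℤ → ℂ, (∀ k ∈ Set.Icc n m, u k ∈ (μ k).support) → ∀ (N : ℕ) (ε : ℝ), 0 < ε →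
      ∃ l : ℤ, ∀ j ∈ Set.Ico l (l + N), ∀ k ∈ Set.Icc n m,
        ‖matrixEntry e (A ω) (j + k) j - u k‖ ≤ ε := by
  set D := TopologicalSpace.denseSeq ℂ with hD
  set X : Set.Icc n m × ℤ → Ω → ℂ := fun p ω => matrixEntry e (A ω) (p.2 + (p.1 : ℤ)) p.2 with hX
  -- The symbols `u` are uncountably many; balls with centres in a dense sequence and radii `1 / (M
  -- + 1)` leave countably many almost sure events.
  have key : ∀ᵐ ω ∂P, ∀ (q : Set.Icc n m → ℕ) (M N : ℕ),
      (∀ k : Set.Icc n m, μ k (Metric.ball (D (q k)) (1 / ((M : ℝ) + 1))) ≠ 0) →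
      ∃ l : ℤ, ∀ j ∈ Set.Ico l (l + N), ∀ k,
        X (k, j) ω ∈ Metric.ball (D (q k)) (1 / ((M : ℝ) + 1)) := by
    refine ae_all_iff.2 fun q => ae_all_iff.2 fun M => ae_all_iff.2 fun N => ?_
    by_cases hpos : ∀ k : Set.Icc n m, μ k (Metric.ball (D (q k)) (1 / ((M : ℝ) + 1))) ≠ 0
    · filter_upwards [ae_exists_window (X := X) (μ := fun k : Set.Icc n m => μ k) (fun p => hμ p.1 p.1.2 p.2)
        hA.indep (fun k => measurableSet_ball) hpos N] with ω hω _ using hω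
    · exact Filter.Eventually.of_forall fun ω h => absurd h hpos
  filter_upwards [key] with ω hω u hu N ε hε
  obtain ⟨M, hM⟩ := exists_nat_one_div_lt (half_pos hε)
  have hpos : (0 : ℝ) < 1 / ((M : ℝ) + 1) := by positivity
  have hq : ∀ k : Set.Icc n m, ∃ i, dist (u k) (D i) < 1 / ((M : ℝ) + 1) := fun k =>
    (TopologicalSpace.denseRange_denseSeq ℂ).exists_dist_lt (u k) hpos
  choose q hq using hq
  obtain ⟨l, hl⟩ := hω q M N fun k : Set.Icc n m =>
    ((Measure.mem_support_iff_forall _).1 (hu k k.2) _ (Metric.isOpen_ball.mem_nhds (hq k))).ne'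
  refine ⟨l, fun j hj k hk => ?_⟩
  have h1 := hl j hj ⟨k, hk⟩
  rw [Metric.mem_ball] at h1
  have h2 := hq ⟨k, hk⟩
  rw [dist_comm] at h2
  rw [← dist_eq_norm]
  have h3 := dist_triangle (X (⟨k, hk⟩, j) ω) (D (q ⟨k, hk⟩)) (u k)
  simp only [hX] at h1 h3
  linarith

end Probability

/-- The laws need not charge all of `U k`, so `A` may fail to be pseudo-ergodic over `U`. Almost
surely its entries lie in `U k ∩ (μ k).support`, and over these sets the deterministic criterion
applies. -/
theorem ae_closedNumericalRange_eq_of_isRandomBandOperator {H : Type*} [NormedAddCommGroup H]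
    [InnerProductSpace ℂ H] [CompleteSpace H] {e : HilbertBasis ℤ ℂ H} {U : ℤ → Set ℂ}
    (hU : ∀ k ∈ Set.Icc (-1 : ℤ) 1, (U k).Nonempty ∧ IsCompact (U k))
    {Ω : Type*} [MeasurableSpace Ω] {P : Measure Ω} [IsProbabilityMeasure P]
    {A : Ω → (H →L[ℂ] H)} (hA : IsRandomBandOperator P e (-1) 1 U A) :
    ∀ᵐ ω ∂P, closedNumericalRange (A ω) = convexHull ℝ (spectrum ℂ (A ω)) := by
  choose! μ hμP hμU hμ using hA.law
  have hsupp : ∀ᵐ ω ∂P, ∀ k i : ℤ, k ∈ Set.Icc (-1 : ℤ) 1 →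
      matrixEntry e (A ω) (i + k) i ∈ (μ k).support := by
    refine ae_all_iff.2 fun k => ae_all_iff.2 fun i => ?_
    by_cases hk : k ∈ Set.Icc (-1 : ℤ) 1
    · have h1 : ∀ᵐ z ∂(P.map fun ω => matrixEntry e (A ω) (i + k) i), z ∈ (μ k).support := by
        rw [(hμ k hk i).map_eq]
        exact Measure.support_mem_ae
      filter_upwards [ae_of_ae_map (hμ k hk i).aemeasurable h1] with ω hω _ using hω
    · exact Filter.Eventually.of_forall fun ω h => absurd h hk
  filter_upwards [hA.mem, hsupp, ae_exists_window_of_isRandomBandOperator hA hμ] with ω h1 h2 h3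
  refine closedNumericalRange_eq_convexHull_spectrum (e := e)
    (V := fun k => U k ∩ (μ k).support) (fun k hk => ⟨?_, ?_⟩)
    (fun i k => ⟨fun hk => ⟨(h1 i k).1 hk, h2 k i hk⟩, (h1 i k).2⟩)
    fun u hu => h3 u fun k hk => (hu k hk).2
  · exact ⟨_, (h1 0 k).1 hk, h2 k 0 hk⟩
  · exact (hU k hk).2.inter_right Measure.isClosed_support

theorem mainTheorem2 {H : Type*} [NormedAddCommGroup H] [InnerProductSpace ℂ H] [CompleteSpace H]
    (e : HilbertBasis ℤ ℂ H) :
    (∀ U : ℤ → Set ℂ, (∀ k ∈ Set.Icc (-1 : ℤ) 1, (U k).Nonempty ∧ IsCompact (U k)) →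
      ∀ A ∈ pseudoErgodicOperators e (-1) 1 U,
        closedNumericalRange A = convexHull ℝ (spectrum ℂ A)) ∧
    (∃ U : ℤ → Set ℂ, (∀ k ∈ Set.Icc (-1 : ℤ) 1, (U k).Nonempty ∧ IsCompact (U k)) ∧
      ∃ A ∈ pseudoErgodicOperators e (-1) 1 U, ¬ IsStarNormal A) ∧
    (∀ U : ℤ → Set ℂ, (∀ k ∈ Set.Icc (-1 : ℤ) 1, (U k).Nonempty ∧ IsCompact (U k)) →
      ∀ (Ω : Type*) [MeasurableSpace Ω] (P : Measure Ω) [IsProbabilityMeasure P]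
        (A : Ω → (H →L[ℂ] H)), IsRandomBandOperator P e (-1) 1 U A →
        ∀ᵐ ω ∂P, closedNumericalRange (A ω) = convexHull ℝ (spectrum ℂ (A ω))) := by
  refine ⟨fun U hU A hA => ?_, exists_pseudoErgodic_not_isStarNormal e,
    fun U hU Ω _ P _ A hA => ae_closedNumericalRange_eq_of_isRandomBandOperator hU hA⟩
  exact closedNumericalRange_eq_convexHull_spectrum hU hA.1 fun u hu n ε hε =>
    exists_window_of_mem_pseudoErgodicOperators hA hu n hε
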